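/- \textbf{Setting.} A network has finitely many output ports (nodes) and finitely many flows. Each flow $f$ has a static class, a static path visiting no node twice, and a token-bucket arrival curve $\gamma_{r_f,b_f}$ at its source, where $\gamma_{r,b}(0)=0$ and $\gamma_{r,b}(t)=rt+b$ for $t>0$. Fix a class $c$. Its induced graph $\mathcal G_c$ has an edge $(v,u)$ whenever some flow of class $c$ goes directly from $v$ to $u$. Let $E^{\rm cut}$ be a set of edges whose removal leaves a forest whose trees are directed towards their roots. At the cut edges the flows of class $c$ are split: each flow becomes one or several flows of the cut network, a flow $p$ of the cut network having rate $r_p$ (the rate of the original flow), a source node $v_p$, and a burst $\bar b_p$, equal to the original burst if $v_p$ is the first node of the original flow, and to the given bound $z$ on the burstiness of that flow on the cut edge by which it enters $v_p$ otherwise. A trajectory of class $c$ consists of cumulative (non-decreasing, left-continuous, null at $0$) arrivals and departures of every flow of class $c$ at every node of its path, such that departures are continuous and do not exceed arrivals, the departures from a node are the arrivals at the next node of the path, every node is FIFO for the class, every flow is constrained by $\gamma_{r_f,b_f}$ at its source, and the aggregate of class $c$ leaving $v$ on any edge $(v,u)$ has arrival curve $\gamma_{R^v,l^{\max}_c}$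 (line shaping, with $R^v$ the line rate). Assume given, for every node $v$, a curve $\beta^v(t)=\max_q R^v_q\,[t-T^v_q]^+$ (finitely many $q$, $R^v_q,T^v_q\ge 0$) that is a strict service curve offered by $v$ to the class, a delay bound $d^v\in[0,\infty]$, and burstiness bounds $z\in[0,\infty]$ for every flow on every cut edge, all of them valid for the trajectory. \textbf{Linear program.} Let $g$ be a node $\rho$ or an edge $(\rho,w)$ of $\mathcal G_c$. Consider the sub-tree $\mathcal T$ of the cut graph rooted at $\rho$, with an artificial successor $v_0$ of $\rho$; let $\mathrm{sc}(v)$ be the successor of $v$, $\mathrm{dp}(v_0)=0$ and $\mathrm{dp}(v)=\mathrm{dp}(\mathrm{sc}(v))+1$. Let $\mathrm{In}(v)$ be the set of flows of the cut network traversing $v$. Let $F$ be the set of flows of the cut network that traverse $\rho$ and, if $g=(\rho,w)$, whose original flow leaves $\rho$ by the edge $g$. The real variables are $t_{v,k}$ (times) and $F^{v}_{p}(v',k)$ (cumulative arrivals of flow $p$ at node $v$ at time $t_{v',k}$). The constraints are, for every $v\in\mathcal T$ with $u=\mathrm{sc}(v)$, and every flow $p$ of the cut network with $v_p\in\mathcal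 T$: \begin{itemize} \item time: $t_{v,k}\ge t_{v,k+1}$ for $0\le k<\mathrm{dp}(v)$, and $t_{v,k}\le t_{u,k}$ for $0\le k\le \mathrm{dp}(u)$; \item FIFO: $F^{v}_{p'}(v,k)=F^{u}_{p'}(u,k)$ for $0\le k\le\mathrm{dp}(u)$ and $p'\in \mathrm{In}(v)$; \item service: $S_v:=\sum_{p'\in \mathrm{In}(v)}\big(F^{u}_{p'}(u,\mathrm{dp}(u))-F^{v}_{p'}(v,\mathrm{dp}(v))\big)\ge 0$ and $S_v\ge R^v_q\,(t_{u,\mathrm{dp}(u)}-t_{v,\mathrm{dp}(v)}-T^v_q)$ for all $q$; \item delay: $t_{u,k}-t_{v,k}\le d^v$ for $0\le k\le \mathrm{dp}(u)$; \item arrivals: $F^{v_p}_{p}(v_p,k)-F^{v_p}_{p}(v_p,k')\le \bar b_p+r_p\,(t_{v_p,k}-t_{v_p,k'})$ for $0\le k<k'\le \mathrm{dp}(v_p)$; \item shaping: $\sum_{p'}\big(F^{u}_{p'}(u,k)-F^{u}_{p'}(u,k')\big)\le l^{\max}_c+R^v(t_{u,k}-t_{u,k'})$ for $0\le k<k'\le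 \mathrm{dp}(u)$, where $p'$ ranges over the flows of the cut network carried by $(v,u)$ that are not in $F$; \item monotonicity: $F^{v_p}_{p}(v_p,k)\ge F^{v_p}_{p}(v_p,k+1)$ for $0\le k<\mathrm{dp}(v_p)$; \item flows of interest: $F^{v_p}_{p}(v_0,0)-F^{v_p}_{p}(v_p,k)\le \bar b_p+r_p\,(t_{v_0,0}-t_{v_p,k})$ for $p\in F$ and $0\le k\le\mathrm{dp}(v_p)$; \end{itemize} constraints with an infinite bound being void. The objective is to maximize $\sum_{p\in F}\big(F^{v_p}_{p}(v_0,0)-F^{v_0}_{p}(v_0,0)\big)$. Let $\mathcal B\in[0,\infty]$ be its optimum (supremum). \textbf{Theorem.} $\mathcal B$ is a valid bound on the aggregate burstiness at $g$: if $g=\rho$ is a node (resp. $g=(\rho,w)$ is an edge), the aggregate output at node $\rho$ of the flows of class $c$ that traverse $\rho$ (resp. of the flows of class $c$ carried by $g$) has arrival curve $\gamma_{r,\mathcal B}$, where $r=\sum_f r_f$ is the sum of the rates of these flows. -/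

import Mathlib

open scoped NNReal ENNReal

namespace PLP

/-! ### Cumulative functions, arrival curves, service curves -/

/-- A cumulative function: non-decreasing, left-continuous, null at time `0`. -/
structure IsCumulative (A : ℝ≥0 → ℝ) : Prop where
  mono : Monotone A
  zero : A 0 = 0
  leftCont : ∀ t, ContinuousWithinAt A (Set.Iic t) t

/-- The token-bucket function `γ_{r,b}`: `0` at `0`, and `r τ + b` for `τ > 0`.
The burst may be infinite. -/
noncomputable def tokenBucket (r : ℝ≥0) (b : EReal) (τ : ℝ≥0) : EReal :=
  if τ = 0 then 0 else b + ((r * τ : ℝ) : EReal)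

/-- `α` is an arrival curve for `A`. -/
def HasArrivalCurve (A : ℝ≥0 → ℝ) (α : ℝ≥0 → EReal) : Prop :=
  ∀ s τ : ℝ≥0, ((A (s + τ) - A s : ℝ) : EReal) ≤ α τ

/-- The piecewise linear convex curve `max_p β_{R_p, T_p}`, given by the finite set of its
pairs `(R_p, T_p)`. Subtraction in `ℝ≥0` is the positive part of the difference. -/
noncomputable def serviceCurve (P : Finset (ℝ≥0 × ℝ≥0)) (τ : ℝ≥0) : ℝ≥0 :=
  P.sup fun p => p.1 * (τ - p.2)

/-- `β` is a strict service curve for a server with arrivals `A` and departures `D`: in every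
backlogged period `(s, t]`, at least `β (t - s)` is served. -/
def IsStrictServiceCurve (A D : ℝ≥0 → ℝ) (β : ℝ≥0 → ℝ≥0) : Prop :=
  ∀ s t, s ≤ t → (∀ u, s < u → u ≤ t → D u < A u) → (β (t - s) : ℝ) ≤ D t - D s

/-! ### Networks, induced graphs, cuts -/

/-- A network with (non-terminal) output ports `V`, flows `Φ` and classes `C`.
Each flow has a static path, a static class, and a token-bucket arrival curve
`γ_{rate, burst}` at its source; each output port has a line rate. -/
structure Network (V Φ C : Type*) where
  path : Φ → List V
  path_ne_nil : ∀ f, path f ≠ []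
  path_nodup : ∀ f, (path f).Nodup
  cls : Φ → C
  rate : Φ → ℝ≥0
  burst : Φ → ℝ≥0
  lineRate : V → ℝ≥0
  maxPacket : C → ℝ≥0

section

variable {V Φ C : Type*} (N : Network V Φ C) (c : C) (cut : Set (V × V))

/-- Flow `f` goes directly from `v` to `u`. -/
def Network.Carries (f : Φ) (v u : V) : Prop := [v, u] <:+: N.path f

/-- Edges of the graph induced by the flows of class `c`. -/
def Network.Edge (v u : V) : Prop := ∃ f, N.cls f = c ∧ N.Carries f v u

/-- Edges of the cut graph of class `c`. -/
def Network.TreeEdge (v u : V) : Prop := N.Edge c v u ∧ (v, u) ∉ cut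

/-- `cut` is a set of edges of the induced graph whose removal leaves a forest, every tree of
which is directed towards its root. -/
structure Network.IsForestCut : Prop where
  subset : ∀ v u, (v, u) ∈ cut → N.Edge c v u
  unique : ∀ v u w, N.TreeEdge c cut v u → N.TreeEdge c cut v w → u = w
  acyclic : ∀ v, ¬ Relation.TransGen (N.TreeEdge c cut) v v

/-- Nodes of the sub-tree of the cut graph that is rooted at `ρ`. -/
def Network.subtree (ρ : V) : Set V :=
  {v | Relation.ReflTransGen (N.TreeEdge c cut) v ρ}

open Classical in
/-- Successor of a node in the sub-tree rooted at `ρ`; the artificial successor `v₀` of the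
root is `none`. -/
noncomputable def Network.sc (ρ v : V) : Option V :=
  if v = ρ then none
  else if h : ∃ u, N.TreeEdge c cut v u then some h.choose else none

/-- Depth of a node in the sub-tree rooted at `ρ`: the number of steps to `v₀`. -/
noncomputable def Network.dp (ρ : V) (x : Option V) : ℕ :=
  sInf {n | (fun y : Option V => y.bind (N.sc c cut ρ))^[n] x = none}

/-- A pair `(f, e)` is a flow of the cut network of class `c`: `f` is a flow of class `c`, and
`e` is either the first node of `f` (a fresh flow) or the node that `f` enters by a cut edge
(a cut flow). Its source node is `e`. -/
def Network.IsPiece (p : Φ × V) : Prop :=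
  N.cls p.1 = c ∧
    ((N.path p.1).head? = some p.2 ∨ ∃ w, N.Carries p.1 w p.2 ∧ (w, p.2) ∈ cut)

/-- The flow `p` of the cut network traverses `v`: the path of the original flow leads from
the source node of `p` to `v` without crossing a cut edge. -/
def Network.Visits (p : Φ × V) (v : V) : Prop :=
  Relation.ReflTransGen (fun a b => N.Carries p.1 a b ∧ (a, b) ∉ cut) p.2 v

open Classical in
/-- Burstiness bound of a flow of the cut network at its source node: the burst of the flow
for a fresh flow, the given bound `z w e f` for flow `f` on the cut edge `(w, e)` otherwise.
The infimum is over the unique `w` that precedes `e` on the path. -/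
noncomputable def Network.pieceBurst (z : V → V → Φ → ℝ≥0∞) (p : Φ × V) : ℝ≥0∞ :=
  if (N.path p.1).head? = some p.2 then (N.burst p.1 : ℝ≥0∞)
  else ⨅ (w : V) (_ : N.Carries p.1 w p.2), z w p.2 p.1

open Classical in
/-- Flows of class `c` that traverse `v`. -/
noncomputable def Network.flowsAt [Fintype Φ] (v : V) : Finset Φ :=
  {f | N.cls f = c ∧ v ∈ N.path f}

open Classical in
/-- Flows of class `c` carried by the edge `(v, u)`. -/
noncomputable def Network.flowsOn [Fintype Φ] (v u : V) : Finset Φ :=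
  {f | N.cls f = c ∧ N.Carries f v u}

open Classical in
/-- Flows of the cut network that traverse `v`. -/
noncomputable def Network.piecesAt [Fintype V] [Fintype Φ] (v : V) : Finset (Φ × V) :=
  {p | N.IsPiece c cut p ∧ N.Visits cut p v}

open Classical in
/-- Flows of the cut network that traverse `v` and leave it by the edge `(v, u)`. -/
noncomputable def Network.piecesOn [Fintype V] [Fintype Φ] (v u : V) : Finset (Φ × V) :=
  {p | N.IsPiece c cut p ∧ N.Visits cut p v ∧ N.Carries p.1 v u}

/-! ### The linear program -/

/-- Variables of the linear program. `t v k` is the time variable of index `k` at node `v`;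
`Ft v p w k` is the variable for the cumulative arrivals of flow `p` at the input of node `v`
at the time `t w k`. The node `none` is `v₀`. -/
structure Vars (V Φ : Type*) where
  t : Option V → ℕ → ℝ
  Ft : Option V → Φ × V → Option V → ℕ → ℝ

/-- Objective of the linear program: the total backlog of the flows of interest. -/
def objective {V Φ : Type*} (F : Finset (Φ × V)) (x : Vars V Φ) : ℝ :=
  ∑ p ∈ F, (x.Ft (some p.2) p none 0 - x.Ft none p none 0)

variable [Fintype V] [Fintype Φ]

open Classical in
/-- Constraints of the linear program for the sub-tree rooted at `ρ` and the set `F` of flows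
of interest, with service curves `max_p β_{R_p, T_p}` given by `β`, per-node delay bounds `d`
and bounds `z` on the burstiness of flows at cuts. Constraints with an infinite bound always
hold. -/
structure Feasible (β : V → Finset (ℝ≥0 × ℝ≥0)) (d : V → ℝ≥0∞) (z : V → V → Φ → ℝ≥0∞)
    (ρ : V) (F : Finset (Φ × V)) (x : Vars V Φ) : Prop where
  time_index : ∀ v ∈ N.subtree c cut ρ, ∀ k, k + 1 ≤ N.dp c cut ρ (some v) →
    x.t (some v) (k + 1) ≤ x.t (some v) k
  time_succ : ∀ v ∈ N.subtree c cut ρ, ∀ k ≤ N.dp c cut ρ (N.sc c cut ρ v),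
    x.t (some v) k ≤ x.t (N.sc c cut ρ v) k
  fifo : ∀ v ∈ N.subtree c cut ρ, ∀ k ≤ N.dp c cut ρ (N.sc c cut ρ v),
    ∀ p ∈ N.piecesAt c cut v,
      x.Ft (some v) p (some v) k = x.Ft (N.sc c cut ρ v) p (N.sc c cut ρ v) k
  service_nonneg : ∀ v ∈ N.subtree c cut ρ,
    0 ≤ (∑ p ∈ N.piecesAt c cut v,
          x.Ft (N.sc c cut ρ v) p (N.sc c cut ρ v) (N.dp c cut ρ (N.sc c cut ρ v)))
        - ∑ p ∈ N.piecesAt c cut v, x.Ft (some v) p (some v) (N.dp c cut ρ (some v))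
  service : ∀ v ∈ N.subtree c cut ρ, ∀ q ∈ β v,
    (q.1 : ℝ) * (x.t (N.sc c cut ρ v) (N.dp c cut ρ (N.sc c cut ρ v))
        - x.t (some v) (N.dp c cut ρ (some v)) - q.2)
      ≤ (∑ p ∈ N.piecesAt c cut v,
          x.Ft (N.sc c cut ρ v) p (N.sc c cut ρ v) (N.dp c cut ρ (N.sc c cut ρ v)))
        - ∑ p ∈ N.piecesAt c cut v, x.Ft (some v) p (some v) (N.dp c cut ρ (some v))
  delay : ∀ v ∈ N.subtree c cut ρ, ∀ k ≤ N.dp c cut ρ (N.sc c cut ρ v),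
    ((x.t (N.sc c cut ρ v) k - x.t (some v) k : ℝ) : EReal) ≤ (d v : EReal)
  arrival : ∀ p, N.IsPiece c cut p → p.2 ∈ N.subtree c cut ρ →
    ∀ k k', k < k' → k' ≤ N.dp c cut ρ (some p.2) →
      ((x.Ft (some p.2) p (some p.2) k - x.Ft (some p.2) p (some p.2) k'
          - N.rate p.1 * (x.t (some p.2) k - x.t (some p.2) k') : ℝ) : EReal)
        ≤ (N.pieceBurst z p : EReal)
  shaping : ∀ v ∈ N.subtree c cut ρ, ∀ u, N.sc c cut ρ v = some u →
    ∀ k k', k < k' → k' ≤ N.dp c cut ρ (some u) →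
      ∑ p ∈ N.piecesOn c cut v u \ F,
          (x.Ft (some u) p (some u) k - x.Ft (some u) p (some u) k')
        ≤ N.maxPacket c + N.lineRate v * (x.t (some u) k - x.t (some u) k')
  monotone : ∀ p, N.IsPiece c cut p → p.2 ∈ N.subtree c cut ρ →
    ∀ k, k + 1 ≤ N.dp c cut ρ (some p.2) →
      x.Ft (some p.2) p (some p.2) (k + 1) ≤ x.Ft (some p.2) p (some p.2) k
  interest : ∀ p ∈ F, ∀ k ≤ N.dp c cut ρ (some p.2),
    ((x.Ft (some p.2) p none 0 - x.Ft (some p.2) p (some p.2) k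
        - N.rate p.1 * (x.t none 0 - x.t (some p.2) k) : ℝ) : EReal)
      ≤ (N.pieceBurst z p : EReal)

/-- Optimum of the linear program (possibly infinite). -/
noncomputable def optimum (β : V → Finset (ℝ≥0 × ℝ≥0)) (d : V → ℝ≥0∞)
    (z : V → V → Φ → ℝ≥0∞) (ρ : V) (F : Finset (Φ × V)) : EReal :=
  sSup {y : EReal | ∃ x : Vars V Φ, Feasible N c cut β d z ρ F x ∧
    y = ((objective F x : ℝ) : EReal)}

/-- A place where an aggregate of flows is observed: the output of a node, or an edge. -/
inductive Place (V : Type*) where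
  | node (v : V)
  | edge (v u : V)

/-- Node at the output of which the aggregate is observed; the root of the sub-tree that is
analyzed. -/
def Place.root {V : Type*} : Place V → V
  | .node v => v
  | .edge v _ => v

/-- Flows of class `c` that exit the node, or are carried by the edge. -/
noncomputable def Network.flowsThrough : Place V → Finset Φ
  | .node v => N.flowsAt c v
  | .edge v u => N.flowsOn c v u

/-- The corresponding flows of the cut network. -/
noncomputable def Network.piecesThrough : Place V → Finset (Φ × V)
  | .node v => N.piecesAt c cut v
  | .edge v u => N.piecesOn c cut v u

/-- The aggregate backlog program of class `c` at the node or edge `g`: its optimum. -/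
noncomputable def plpBacklog (β : V → Finset (ℝ≥0 × ℝ≥0)) (d : V → ℝ≥0∞)
    (z : V → V → Φ → ℝ≥0∞) (g : Place V) : EReal :=
  optimum N c cut β d z g.root (N.piecesThrough c cut g)

/-! ### Trajectories of the network and valid bounds -/

/-- A trajectory of the FIFO network formed by the flows of class `c` (the whole network, no
edge being cut): `arr v f` and `dep v f` are the cumulative arrivals of flow `f` at node `v`
and its cumulative departures from `v`. -/
structure Trajectory where
  arr : V → Φ → ℝ≥0 → ℝ
  dep : V → Φ → ℝ≥0 → ℝ
  arr_cumulative : ∀ v, ∀ f ∈ N.flowsAt c v, IsCumulative (arr v f)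
  dep_cumulative : ∀ v, ∀ f ∈ N.flowsAt c v, IsCumulative (dep v f)
  dep_continuous : ∀ v, ∀ f ∈ N.flowsAt c v, Continuous (dep v f)
  causal : ∀ v, ∀ f ∈ N.flowsAt c v, ∀ t, dep v f t ≤ arr v f t
  /-- What leaves a node enters the next node of the path. -/
  link : ∀ v u, ∀ f ∈ N.flowsOn c v u, arr u f = dep v f
  /-- Data is served in the order of arrival: if data of `f` that arrived after `s` has
  left before `t`, all data that arrived before `s` has. -/
  fifo : ∀ v, ∀ f ∈ N.flowsAt c v, ∀ h ∈ N.flowsAt c v, ∀ s t,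
    arr v f s < dep v f t → arr v h s ≤ dep v h t
  source : ∀ f, N.cls f = c → ∀ v, (N.path f).head? = some v →
    HasArrivalCurve (arr v f) (tokenBucket (N.rate f) ((N.burst f : ℝ≥0∞) : EReal))
  /-- Shaping by the transmission line. -/
  shaping : ∀ v u, HasArrivalCurve (fun t => ∑ f ∈ N.flowsOn c v u, dep v f t)
    (tokenBucket (N.lineRate v) ((N.maxPacket c : ℝ≥0∞) : EReal))

variable {N c}

/-- Every node `v` offers the strict service curve `max_p β_{R_p, T_p}` to the class. -/
def Trajectory.StrictService (X : Trajectory N c) (β : V → Finset (ℝ≥0 × ℝ≥0)) : Prop :=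
  ∀ v, IsStrictServiceCurve (fun t => ∑ f ∈ N.flowsAt c v, X.arr v f t)
    (fun t => ∑ f ∈ N.flowsAt c v, X.dep v f t) (serviceCurve (β v))

/-- The delays at node `v` are at most `d v` (no condition if `d v = ∞`). -/
def Trajectory.DelayBound (X : Trajectory N c) (d : V → ℝ≥0∞) : Prop :=
  ∀ v, ∀ f ∈ N.flowsAt c v, ∀ δ : ℝ≥0, d v = δ → ∀ t, X.arr v f t ≤ X.dep v f (t + δ)

/-- On every cut edge `(w, e)`, `z w e f` is a burstiness bound for every flow `f`. -/
def Trajectory.CutBurstBound (X : Trajectory N c) (cut : Set (V × V))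
    (z : V → V → Φ → ℝ≥0∞) : Prop :=
  ∀ w e, (w, e) ∈ cut → ∀ f ∈ N.flowsOn c w e,
    HasArrivalCurve (X.dep w f) (tokenBucket (N.rate f) (z w e f))

/-- Cumulative output of the aggregate of the flows of the class at the node or edge `g`. -/
noncomputable def Trajectory.output (X : Trajectory N c) (g : Place V) (t : ℝ≥0) : ℝ :=
  ∑ f ∈ N.flowsThrough c g, X.dep g.root f t

end
end PLP

/-!
The supremum defining the optimum is bounded below by a single feasible point, read off the
trajectory. To bound the output of the root over `(s, s + τ]`, time `s` is taken at `v₀` and dates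
are computed from successors to predecessors. Each date of the successor of `v` is mapped to the
arrival date at `v` of the data that leaves `v` then (`fifoTime`); one further date is the start of
the backlogged period of `v` that contains the last date of the successor (`backlogStart`). The
cumulative arrivals at `v` at a FIFO date are *defined* as the departures at the successor's date.
At a source node these may lie inside a jump of the arrivals, but they are still between the left
limit and all later arrivals (`arr_le_value`, `value_le_arr`), which is all that the token-bucket
constraints need. Elsewhere arrivals are the continuous departures from the previous node, so there
is no ambiguity (`value_eq_dep_pred`).

For a flow of interest, the variable for its arrivals at its source at time `t_{v₀,0} = s` is given
the value `A(s + τ) - r τ`. Since every date is at most `s`, the token bucket over an interval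
ending at `s + τ` gives exactly the constraint on flows of interest, and since `D(s + τ)` is at
most `A(s + τ)`, the objective is at least the output over `(s, s + τ]` minus `r τ`
(`le_objective_vars`).

Passing between flows and flows of the cut network uses that each flow through a node belongs there
to exactly one flow of the cut network, which starts at its last cut edge before the node, or at its
first node if there is none (`sum_piecesThrough`), and that the forest property leaves a flow at `v` no uncut edge but the one
to the successor of `v`.
-/

namespace PLP

/-! ### One-sided continuity and token buckets -/

lemma apply_csSup_le {A : ℝ≥0 → ℝ} (hA : IsCumulative A) {S : Set ℝ≥0} (hne : S.Nonempty)
    (hbd : BddAbove S) {K : ℝ} (h : ∀ r ∈ S, A r ≤ K) : A (sSup S) ≤ K := by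
  have hc : ContinuousWithinAt A S (sSup S) :=
    (hA.leftCont _).mono fun r hr => le_csSup hbd hr
  have := hc.mem_closure_image (csSup_mem_closure hne hbd)
  refine closure_minimal (t := Set.Iic K) ?_ isClosed_Iic this
  rintro _ ⟨r, hr, rfl⟩
  exact h r hr

lemma le_apply_of_forall_gt {A : ℝ≥0 → ℝ} {T : ℝ≥0} (hA : ContinuousAt A T) {K : ℝ}
    (h : ∀ y, T < y → K ≤ A y) : K ≤ A T :=
  ge_of_tendsto (hA.tendsto.mono_left (nhdsWithin_le_nhds (s := Set.Ioi T)))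
    (eventually_nhdsWithin_of_forall h)

lemma tokenBucket_bound {A : ℝ≥0 → ℝ} {r : ℝ≥0} {b : ℝ≥0∞}
    (h : HasArrivalCurve A (tokenBucket r (b : EReal))) {x y : ℝ≥0} (hxy : x < y) :
    ((A y - A x - r * ((y : ℝ) - x) : ℝ) : EReal) ≤ (b : EReal) := by
  obtain ⟨τ, rfl⟩ := exists_add_of_le hxy.le
  have hτ : τ ≠ 0 := by rintro rfl; simp at hxy
  have h1 := h x τ
  rw [tokenBucket, if_neg hτ] at h1
  induction b with
  | top => simp
  | coe b =>
    have e : ((b : ℝ≥0∞) : EReal) = ((b : ℝ) : EReal) := rfl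
    rw [e, ← EReal.coe_add, EReal.coe_le_coe_iff] at h1
    rw [e, EReal.coe_le_coe_iff]
    push_cast
    linarith

/-- Values read inside a jump of `A` still satisfy the arrival constraint: the earlier value may
exceed the left limit, and the later one only has to be below `A` strictly after `T`. -/
lemma tokenBucket_bound_of_jump {A : ℝ≥0 → ℝ} {r : ℝ≥0} {b : ℝ≥0∞}
    (h : HasArrivalCurve A (tokenBucket r (b : EReal))) {T T' : ℝ≥0} (hT : T' ≤ T) {K K' : ℝ}
    (hK : ∀ y, T < y → K ≤ A y) (hK' : A T' ≤ K') :
    ((K - K' - r * ((T : ℝ) - T') : ℝ) : EReal) ≤ (b : EReal) := by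
  induction b with
  | top => simp
  | coe b =>
    have e : ((b : ℝ≥0∞) : EReal) = ((b : ℝ) : EReal) := rfl
    rw [e, EReal.coe_le_coe_iff]
    have hc : ContinuousAt (fun y : ℝ≥0 => (b : ℝ) + r * ((y : ℝ) - T')) T := by fun_prop
    have : K - K' ≤ (b : ℝ) + r * ((T : ℝ) - T') := by
      refine le_apply_of_forall_gt (A := fun y : ℝ≥0 => (b : ℝ) + r * ((y : ℝ) - T')) hc ?_
      intro y hy
      have h1 := tokenBucket_bound h (hT.trans_lt hy)
      rw [e, EReal.coe_le_coe_iff] at h1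
      have := hK y hy
      linarith
    linarith

/-! ### Flows of the cut network -/

section

variable {V Φ C : Type*} {N : Network V Φ C} {c : C} {cut : Set (V × V)} {ρ : V}

lemma Network.carries_iff {f : Φ} {v u : V} :
    N.Carries f v u ↔ ∃ i, (N.path f)[i]? = some v ∧ (N.path f)[i + 1]? = some u := by
  constructor
  · rintro ⟨s, t, h⟩
    refine ⟨s.length, ?_, ?_⟩ <;> simp [← h]
  · rintro ⟨i, h1, h2⟩
    obtain ⟨hi, rfl⟩ := List.getElem?_eq_some_iff.1 h1
    obtain ⟨hj, rfl⟩ := List.getElem?_eq_some_iff.1 h2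
    refine ⟨(N.path f).take i, (N.path f).drop (i + 2), ?_⟩
    conv_rhs => rw [← List.take_append_drop i (N.path f), List.drop_eq_getElem_cons hi,
      List.drop_eq_getElem_cons hj]
    simp

lemma Network.index_unique {f : Φ} {v : V} {i j : ℕ} (hi : (N.path f)[i]? = some v)
    (hj : (N.path f)[j]? = some v) : i = j := by
  obtain ⟨h1, h1'⟩ := List.getElem?_eq_some_iff.1 hi
  obtain ⟨h2, h2'⟩ := List.getElem?_eq_some_iff.1 hj
  exact (N.path_nodup f).getElem_inj_iff.1 (h1'.trans h2'.symm)

lemma Network.Carries.right_unique {f : Φ} {v u w : V} (hu : N.Carries f v u)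
    (hw : N.Carries f v w) : u = w := by
  obtain ⟨i, hi, hi'⟩ := carries_iff.1 hu
  obtain ⟨j, hj, hj'⟩ := carries_iff.1 hw
  obtain rfl := index_unique hi hj
  exact Option.some_inj.1 (hi'.symm.trans hj')

lemma Network.Carries.left_unique {f : Φ} {v w u : V} (hv : N.Carries f v u)
    (hw : N.Carries f w u) : v = w := by
  obtain ⟨i, hi, hi'⟩ := carries_iff.1 hv
  obtain ⟨j, hj, hj'⟩ := carries_iff.1 hw
  obtain rfl : i = j := Nat.succ_injective (index_unique hi' hj')
  exact Option.some_inj.1 (hi.symm.trans hj)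

lemma Network.Carries.head?_ne {f : Φ} {v u : V} (h : N.Carries f v u) :
    (N.path f).head? ≠ some u := by
  intro h0
  obtain ⟨i, -, hi'⟩ := carries_iff.1 h
  rw [List.head?_eq_getElem?] at h0
  exact absurd (index_unique h0 hi') (by omega)

lemma Network.Carries.left_mem {f : Φ} {v u : V} (h : N.Carries f v u) : v ∈ N.path f :=
  h.subset (by simp)

lemma Network.Carries.right_mem {f : Φ} {v u : V} (h : N.Carries f v u) : u ∈ N.path f :=
  h.subset (by simp)

lemma Network.IsPiece.source_mem {p : Φ × V} (hp : N.IsPiece c cut p) : p.2 ∈ N.path p.1 := by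
  obtain ⟨-, h | ⟨w, h, -⟩⟩ := hp
  · exact List.mem_of_head? h
  · exact h.right_mem

lemma Network.Visits.mem_path {p : Φ × V} {v : V} (hp : N.IsPiece c cut p)
    (h : N.Visits cut p v) : v ∈ N.path p.1 := by
  rcases Relation.ReflTransGen.cases_tail h with rfl | ⟨w, -, hw, -⟩
  · exact hp.source_mem
  · exact hw.right_mem

/-- A flow of the cut network is not entered by an uncut edge at its source node. -/
lemma Network.IsPiece.not_step {p : Φ × V} (hp : N.IsPiece c cut p) {w : V} :
    ¬ (N.Carries p.1 w p.2 ∧ (w, p.2) ∉ cut) := by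
  rintro ⟨hw, hwc⟩
  obtain ⟨-, h | ⟨w', h, hc⟩⟩ := hp
  · exact hw.head?_ne h
  · exact hwc (hw.left_unique h ▸ hc)

lemma Network.exists_piece {f : Φ} (hf : N.cls f = c) {v : V} (hv : v ∈ N.path f) :
    ∃ e, N.IsPiece c cut (f, e) ∧ N.Visits cut (f, e) v := by
  obtain ⟨i, hi⟩ := List.getElem?_of_mem hv
  clear hv
  induction i generalizing v with
  | zero =>
    exact ⟨v, ⟨hf, Or.inl (by rw [List.head?_eq_getElem?]; exact hi)⟩, Relation.ReflTransGen.refl⟩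
  | succ i ih =>
    obtain ⟨hi', -⟩ := List.getElem?_eq_some_iff.1 hi
    have hw : (N.path f)[i]? = some ((N.path f)[i]) := List.getElem?_eq_getElem (by omega)
    obtain ⟨e, he, hev⟩ := ih hw
    have hc : N.Carries f (N.path f)[i] v := carries_iff.2 ⟨i, hw, hi⟩
    by_cases h : ((N.path f)[i], v) ∈ cut
    · exact ⟨v, ⟨hf, Or.inr ⟨_, hc, h⟩⟩, Relation.ReflTransGen.refl⟩
    · exact ⟨e, he, hev.tail ⟨hc, h⟩⟩

lemma Network.piece_unique {p q : Φ × V} (hp : N.IsPiece c cut p) (hq : N.IsPiece c cut q)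
    (hpq : p.1 = q.1) {v : V} (hpv : N.Visits cut p v) (hqv : N.Visits cut q v) : p = q := by
  obtain ⟨f, e⟩ := p
  obtain ⟨f', e'⟩ := q
  obtain rfl : f = f' := hpq
  -- Steps of a flow are deterministic backwards, so one of the sources leads to the other.
  have key := Relation.ReflTransGen.total_of_right_unique
    (r := Function.swap fun a b => N.Carries f a b ∧ (a, b) ∉ cut)
    (fun a b b' h h' => h.1.left_unique h'.1)
    (Relation.ReflTransGen.swap _ _ hpv) (Relation.ReflTransGen.swap _ _ hqv)
  rcases key with h | h
  · rcases Relation.ReflTransGen.cases_head h with h | ⟨w, hw, -⟩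
    · exact Prod.ext rfl h
    · exact absurd hw hp.not_step
  · rcases Relation.ReflTransGen.cases_head h with h | ⟨w, hw, -⟩
    · exact Prod.ext rfl h.symm
    · exact absurd hw hq.not_step

lemma Network.IsPiece.treeEdge {p : Φ × V} (hp : N.IsPiece c cut p) {a b : V}
    (h : N.Carries p.1 a b ∧ (a, b) ∉ cut) : N.TreeEdge c cut a b :=
  ⟨⟨p.1, hp.1, h.1⟩, h.2⟩

/-- If a flow goes on from `v` to another node by uncut edges, it leaves `v` by the tree edge. -/
lemma Network.IsForestCut.step_eq (hcut : N.IsForestCut c cut) {p : Φ × V}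
    (hp : N.IsPiece c cut p) {v u w : V} (hvu : N.TreeEdge c cut v u) (hne : v ≠ w)
    (h : Relation.ReflTransGen (fun a b => N.Carries p.1 a b ∧ (a, b) ∉ cut) v w) :
    N.Carries p.1 v u := by
  rcases Relation.ReflTransGen.cases_head h with h | ⟨x, hx, -⟩
  · exact absurd h hne
  · rw [hcut.unique v u x hvu (hp.treeEdge hx)]
    exact hx.1

lemma Network.Visits.total {p : Φ × V} {v w : V} (hv : N.Visits cut p v) (hw : N.Visits cut p w) :
    Relation.ReflTransGen (fun a b => N.Carries p.1 a b ∧ (a, b) ∉ cut) v w ∨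
    Relation.ReflTransGen (fun a b => N.Carries p.1 a b ∧ (a, b) ∉ cut) w v :=
  Relation.ReflTransGen.total_of_right_unique (fun _ _ _ h h' => h.1.right_unique h'.1) hv hw

lemma Network.IsForestCut.carries_of_visits (hcut : N.IsForestCut c cut) {p : Φ × V}
    (hp : N.IsPiece c cut p) {v u : V} (hvu : N.TreeEdge c cut v u) (hv : N.Visits cut p v)
    (hu : N.Visits cut p u) : N.Carries p.1 v u := by
  have hne : v ≠ u := by
    rintro rfl
    exact hcut.acyclic v (.single hvu)
  rcases hv.total hu with h | h
  · exact hcut.step_eq hp hvu hne h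
  · exact absurd (Relation.TransGen.head' hvu 
      (Relation.ReflTransGen.mono (fun _ _ hab => hp.treeEdge hab) _ _ h))
      (hcut.acyclic v)

/-- A flow that does not visit `u` visits at most one node whose successor is `u`. -/
lemma Network.IsForestCut.pred_unique (hcut : N.IsForestCut c cut) {p : Φ × V}
    (hp : N.IsPiece c cut p) {v w u : V} (hvu : N.TreeEdge c cut v u)
    (hwu : N.TreeEdge c cut w u) (hv : N.Visits cut p v) (hw : N.Visits cut p w)
    (hu : ¬ N.Visits cut p u) : v = w := by
  by_contra hne
  rcases hv.total hw with h | h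
  · exact hu (hv.tail ⟨hcut.step_eq hp hvu hne h, hvu.2⟩)
  · exact hu (hw.tail ⟨hcut.step_eq hp hwu (Ne.symm hne) h, hwu.2⟩)

lemma Network.Visits.source_mem_subtree {p : Φ × V} (hp : N.IsPiece c cut p) {v : V}
    (hv : N.Visits cut p v) (hvρ : v ∈ N.subtree c cut ρ) : p.2 ∈ N.subtree c cut ρ :=
  Relation.ReflTransGen.trans (Relation.ReflTransGen.mono (fun _ _ hab => hp.treeEdge hab) _ _ hv)
    hvρ

/-! ### Successors and depths in the sub-tree -/

@[simp] lemma Network.sc_root : N.sc c cut ρ ρ = none := by simp [Network.sc]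

lemma Network.sc_eq_some {v u : V} (h : N.sc c cut ρ v = some u) :
    v ≠ ρ ∧ N.TreeEdge c cut v u := by
  unfold Network.sc at h
  split_ifs at h with h1 h2
  exact ⟨h1, Option.some_inj.1 h ▸ h2.choose_spec⟩

lemma Network.IsForestCut.sc_cases (hcut : N.IsForestCut c cut) {v : V}
    (hv : v ∈ N.subtree c cut ρ) :
    (v = ρ ∧ N.sc c cut ρ v = none) ∨
      ∃ u ∈ N.subtree c cut ρ, N.sc c cut ρ v = some u ∧ N.TreeEdge c cut v u := by
  by_cases h : v = ρ
  · subst h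
    exact Or.inl ⟨rfl, sc_root⟩
  · right
    rcases Relation.ReflTransGen.cases_head hv with h' | ⟨u, hu, huρ⟩
    · exact absurd h' h
    · have hex : ∃ u, N.TreeEdge c cut v u := ⟨u, hu⟩
      refine ⟨u, huρ, ?_, hu⟩
      rw [Network.sc, if_neg h, dif_pos hex, hcut.unique v _ u hex.choose_spec hu]

@[simp] lemma Network.dp_none : N.dp c cut ρ none = 0 := by
  simp [Network.dp]

lemma Network.IsForestCut.exists_iterate (hcut : N.IsForestCut c cut) {v : V}
    (hv : v ∈ N.subtree c cut ρ) :
    ∃ n, (fun y : Option V => y.bind (N.sc c cut ρ))^[n] (some v) = none := by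
  induction hv using Relation.ReflTransGen.head_induction_on with
  | refl => exact ⟨1, by simp⟩
  | @head a b hab hb ih =>
    rcases hcut.sc_cases (ρ := ρ) (.head hab hb) with ⟨rfl, h⟩ | ⟨u, -, h, hu⟩
    · exact ⟨1, by simp⟩
    · obtain ⟨n, hn⟩ := ih
      obtain rfl := hcut.unique a b u hab hu
      refine ⟨n + 1, ?_⟩
      rw [Function.iterate_succ_apply, Option.bind_some, h, hn]

lemma Network.IsForestCut.dp_some (hcut : N.IsForestCut c cut) {v : V}
    (hv : v ∈ N.subtree c cut ρ) :
    N.dp c cut ρ (some v) = N.dp c cut ρ (N.sc c cut ρ v) + 1 := by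
  have hne := hcut.exists_iterate hv
  unfold Network.dp
  rw [← Nat.sInf_add (n := 1)]
  · congr 1
  · obtain ⟨n, hn⟩ := hne
    refine le_csInf ⟨n, hn⟩ fun m hm => ?_
    rcases m with _ | m
    · simp at hm
    · omega

/-! ### Sums over flows of the cut network -/

variable [Fintype Φ]

lemma Network.mem_flowsAt {v : V} {f : Φ} : f ∈ N.flowsAt c v ↔ N.cls f = c ∧ v ∈ N.path f := by
  simp [Network.flowsAt]

lemma Network.mem_flowsOn {v u : V} {f : Φ} :
    f ∈ N.flowsOn c v u ↔ N.cls f = c ∧ N.Carries f v u := by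
  simp [Network.flowsOn]

lemma Network.mem_flowsAt_of_visits {v : V} {p : Φ × V} (hp : N.IsPiece c cut p)
    (hv : N.Visits cut p v) : p.1 ∈ N.flowsAt c v :=
  mem_flowsAt.2 ⟨hp.1, hv.mem_path hp⟩

variable [Fintype V]

lemma Network.mem_piecesAt {v : V} {p : Φ × V} :
    p ∈ N.piecesAt c cut v ↔ N.IsPiece c cut p ∧ N.Visits cut p v := by
  simp [Network.piecesAt]

lemma Network.mem_piecesOn {v u : V} {p : Φ × V} :
    p ∈ N.piecesOn c cut v u ↔ N.IsPiece c cut p ∧ N.Visits cut p v ∧ N.Carries p.1 v u := by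
  simp [Network.piecesOn]

lemma Network.mem_piecesAt_of_mem_piecesThrough {g : Place V} {p : Φ × V}
    (h : p ∈ N.piecesThrough c cut g) : p ∈ N.piecesAt c cut g.root := by
  cases g with
  | node v => exact h
  | edge v u =>
    obtain ⟨h1, h2, -⟩ := mem_piecesOn.1 h
    exact mem_piecesAt.2 ⟨h1, h2⟩

/-- Each flow observed at `g` corresponds to exactly one flow of the cut network there. -/
lemma Network.sum_piecesThrough (g : Place V) (φ : Φ → ℝ) :
    ∑ p ∈ N.piecesThrough c cut g, φ p.1 = ∑ f ∈ N.flowsThrough c g, φ f := by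
  refine Finset.sum_nbij Prod.fst ?_ ?_ ?_ (fun _ _ => rfl)
  · intro p hp
    cases g with
    | node v =>
      obtain ⟨h1, h2⟩ := mem_piecesAt.1 hp
      exact mem_flowsAt_of_visits h1 h2
    | edge v u =>
      obtain ⟨h1, h2, h3⟩ := mem_piecesOn.1 hp
      exact mem_flowsOn.2 ⟨h1.1, h3⟩
  · intro p hp q hq hpq
    obtain ⟨h1, h2⟩ := mem_piecesAt.1 (mem_piecesAt_of_mem_piecesThrough hp)
    obtain ⟨h3, h4⟩ := mem_piecesAt.1 (mem_piecesAt_of_mem_piecesThrough hq)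
    exact piece_unique h1 h3 hpq h2 h4
  · intro f hf
    cases g with
    | node v =>
      obtain ⟨h1, h2⟩ := mem_flowsAt.1 hf
      obtain ⟨e, he, hev⟩ := exists_piece (cut := cut) h1 h2
      exact ⟨(f, e), mem_piecesAt.2 ⟨he, hev⟩, rfl⟩
    | edge v u =>
      obtain ⟨h1, h2⟩ := mem_flowsOn.1 hf
      obtain ⟨e, he, hev⟩ := exists_piece (cut := cut) h1 h2.left_mem
      exact ⟨(f, e), mem_piecesOn.2 ⟨he, hev, h2⟩, rfl⟩

end

/-! ### FIFO dates and backlogged periods at one node -/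

section

variable {V Φ C : Type*} [Fintype Φ] {N : Network V Φ C} {c : C}
  (X : Trajectory N c)

/-- The arrival date at `v` of the data that leaves `v` at time `t`: the last date, at most `t`,
such that everything that arrived before it has left by `t`. -/
noncomputable def Trajectory.fifoTime (v : V) (t : ℝ≥0) : ℝ≥0 :=
  sSup {r | r ≤ t ∧ ∀ f ∈ N.flowsAt c v, X.arr v f r ≤ X.dep v f t}

/-- Start of the backlogged period of node `v` at time `t`: the last date, at most `t`, at which
no flow of the class has any backlog at `v`. -/
noncomputable def Trajectory.backlogStart (v : V) (t : ℝ≥0) : ℝ≥0 :=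
  sSup {r | r ≤ t ∧ ∀ f ∈ N.flowsAt c v, X.arr v f r = X.dep v f r}

variable {X} {v : V} {t t' : ℝ≥0} {f : Φ}

lemma Trajectory.bddAbove_fifo :
    BddAbove {r | r ≤ t ∧ ∀ f ∈ N.flowsAt c v, X.arr v f r ≤ X.dep v f t} :=
  ⟨t, fun _ h => h.1⟩

lemma Trajectory.bddAbove_backlog :
    BddAbove {r | r ≤ t ∧ ∀ f ∈ N.flowsAt c v, X.arr v f r = X.dep v f r} :=
  ⟨t, fun _ h => h.1⟩

lemma Trajectory.zero_mem_backlog :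
    (0 : ℝ≥0) ∈ {r | r ≤ t ∧ ∀ f ∈ N.flowsAt c v, X.arr v f r = X.dep v f r} :=
  ⟨zero_le, fun f hf => by rw [(X.arr_cumulative v f hf).zero, (X.dep_cumulative v f hf).zero]⟩

lemma Trajectory.backlog_subset_fifo :
    {r | r ≤ t ∧ ∀ f ∈ N.flowsAt c v, X.arr v f r = X.dep v f r} ⊆
    {r | r ≤ t ∧ ∀ f ∈ N.flowsAt c v, X.arr v f r ≤ X.dep v f t} :=
  fun _ hr => ⟨hr.1, fun f hf => (hr.2 f hf).trans_le ((X.dep_cumulative v f hf).mono hr.1)⟩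

lemma Trajectory.backlogStart_le : X.backlogStart v t ≤ t :=
  csSup_le ⟨0, X.zero_mem_backlog⟩ fun _ h => h.1

lemma Trajectory.fifoTime_le : X.fifoTime v t ≤ t :=
  csSup_le ⟨0, X.backlog_subset_fifo X.zero_mem_backlog⟩ fun _ h => h.1

lemma Trajectory.backlogStart_le_fifoTime : X.backlogStart v t ≤ X.fifoTime v t :=
  csSup_le_csSup X.bddAbove_fifo ⟨0, X.zero_mem_backlog⟩ X.backlog_subset_fifo

lemma Trajectory.fifoTime_mono (h : t ≤ t') : X.fifoTime v t ≤ X.fifoTime v t' :=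
  csSup_le_csSup X.bddAbove_fifo ⟨0, X.backlog_subset_fifo X.zero_mem_backlog⟩
    fun _ hr => ⟨hr.1.trans h,
      fun f hf => (hr.2 f hf).trans ((X.dep_cumulative v f hf).mono h)⟩

lemma Trajectory.arr_fifoTime_le (hf : f ∈ N.flowsAt c v) :
    X.arr v f (X.fifoTime v t) ≤ X.dep v f t :=
  apply_csSup_le (X.arr_cumulative v f hf) ⟨0, X.backlog_subset_fifo X.zero_mem_backlog⟩
    X.bddAbove_fifo fun _ hr => hr.2 f hf

/-- The FIFO property: some flow has sent more than its departures just after the FIFO date, hence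
every flow has sent at least its departures. -/
lemma Trajectory.le_arr_of_fifoTime_lt (hf : f ∈ N.flowsAt c v) {y : ℝ≥0}
    (hy : X.fifoTime v t < y) : X.dep v f t ≤ X.arr v f y := by
  rcases le_total y t with h | h
  · by_contra! hlt
    refine hy.not_ge (le_csSup X.bddAbove_fifo ⟨h, fun h hh => ?_⟩)
    exact X.fifo v f hf h hh y t hlt
  · exact (X.causal v f hf t).trans ((X.arr_cumulative v f hf).mono h)

lemma Trajectory.arr_backlogStart (hf : f ∈ N.flowsAt c v) :
    X.arr v f (X.backlogStart v t) = X.dep v f (X.backlogStart v t) := by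
  refine le_antisymm ?_ (X.causal v f hf _)
  refine apply_csSup_le (X.arr_cumulative v f hf) ⟨0, X.zero_mem_backlog⟩ X.bddAbove_backlog ?_
  intro r hr
  exact (hr.2 f hf).trans_le
    ((X.dep_cumulative v f hf).mono (le_csSup X.bddAbove_backlog hr))

lemma Trajectory.arr_backlogStart_le (hf : f ∈ N.flowsAt c v) :
    X.arr v f (X.backlogStart v t) ≤ X.dep v f t :=
  (X.arr_backlogStart hf).trans_le ((X.dep_cumulative v f hf).mono X.backlogStart_le)

lemma Trajectory.DelayBound.sub_fifoTime_le {d : V → ℝ≥0∞} (hd : X.DelayBound d) :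
    (((t : ℝ) - X.fifoTime v t : ℝ) : EReal) ≤ (d v : EReal) := by
  induction h : d v with
  | top => simp
  | coe δ =>
    have e : ((δ : ℝ≥0∞) : EReal) = ((δ : ℝ) : EReal) := rfl
    rw [e, EReal.coe_le_coe_iff]
    have key : t - δ ≤ X.fifoTime v t := by
      rcases le_total t δ with h' | h'
      · simp [tsub_eq_zero_of_le h']
      · refine le_csSup X.bddAbove_fifo ⟨tsub_le_self, fun f hf => ?_⟩
        have := hd v f hf δ h (t - δ)
        rwa [tsub_add_cancel_of_le h'] at this
    have := NNReal.coe_le_coe.2 (tsub_le_iff_right.1 key)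
    push_cast at this
    linarith

lemma Trajectory.StrictService.service_le {β : V → Finset (ℝ≥0 × ℝ≥0)} (hβ : X.StrictService β)
    {q : ℝ≥0 × ℝ≥0} (hq : q ∈ β v) :
    (q.1 : ℝ) * ((t : ℝ) - X.backlogStart v t - q.2) ≤
      ∑ f ∈ N.flowsAt c v, X.dep v f t -
        ∑ f ∈ N.flowsAt c v, X.arr v f (X.backlogStart v t) := by
  have h := hβ v (X.backlogStart v t) t X.backlogStart_le ?_
  · rw [Finset.sum_congr rfl fun f hf => X.arr_backlogStart hf]
    refine le_trans ?_ h
    have h1 : q.1 * (t - X.backlogStart v t - q.2) ≤ serviceCurve (β v) (t - X.backlogStart v t) :=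
      Finset.le_sup (f := fun p : ℝ≥0 × ℝ≥0 => p.1 * (t - X.backlogStart v t - p.2)) hq
    refine le_trans ?_ (NNReal.coe_le_coe.2 h1)
    rw [NNReal.coe_mul]
    refine mul_le_mul_of_nonneg_left ?_ q.1.2
    rw [NNReal.coe_sub_def, NNReal.coe_sub_def]
    exact (sub_le_sub_right (le_max_left _ _) _).trans (le_max_left _ _)
  · intro u hu hut
    have hle : ∀ f ∈ N.flowsAt c v, X.dep v f u ≤ X.arr v f u := fun f hf => X.causal v f hf u
    refine (Finset.sum_le_sum hle).lt_of_ne fun heq => hu.not_ge ?_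
    exact le_csSup X.bddAbove_backlog
      ⟨hut, fun f hf => ((Finset.sum_eq_sum_iff_of_le hle).1 heq f hf).symm⟩

end

/-! ### The point of the linear program read off a trajectory -/

section

variable {V Φ C : Type*} [Fintype Φ] {N : Network V Φ C} {c : C}
  (X : Trajectory N c) (cut : Set (V × V)) (ρ : V) (s : ℝ≥0)

/-- Dates `t_{x,k}`, computed from the root upwards: `s` at `v₀`; FIFO dates of those of the
successor for `k < dp x`; and the start of the backlogged period for `k = dp x`. The first argument
bounds the recursion depth along successors. -/
noncomputable def Trajectory.timeAux : ℕ → Option V → ℕ → ℝ≥0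
  | 0, _, _ => s
  | _ + 1, none, _ => s
  | n + 1, some v, k =>
    if k < N.dp c cut ρ (some v) then X.fifoTime v (timeAux n (N.sc c cut ρ v) k)
    else X.backlogStart v (timeAux n (N.sc c cut ρ v) (N.dp c cut ρ (N.sc c cut ρ v)))

/-- Dates `t_{x,k}` of the trajectory, for the observation time `s` at the output of the root. -/
noncomputable def Trajectory.time (x : Option V) (k : ℕ) : ℝ≥0 :=
  X.timeAux cut ρ s (N.dp c cut ρ x) x k

open Classical in
/-- Cumulative arrivals of `p` at `u` at the date of index `k`. For `k < dp u` this is defined as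
the departures at the corresponding date of the successor, because arrivals at a source node may
jump at the FIFO date. A flow that ends, or is cut, at a predecessor `v` of `u` keeps the value of
its departures from `v`. -/
noncomputable def Trajectory.value (p : Φ × V) (u : V) (k : ℕ) : ℝ :=
  if N.Visits cut p u then
    if k < N.dp c cut ρ (some u) then X.dep u p.1 (X.time cut ρ s (N.sc c cut ρ u) k)
    else X.arr u p.1 (X.time cut ρ s (some u) k)
  else if h : ∃ v, N.sc c cut ρ v = some u ∧ N.Visits cut p v then
    X.dep h.choose p.1 (X.time cut ρ s (some u) k)
  else 0

/-- The point of the linear program for the increment of the output over `(s, s + τ]`. The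
arrivals of a flow of interest at the observation time are taken to be those at time `s + τ`, less
the `r τ` that the token bucket allows over the interval. -/
noncomputable def Trajectory.vars (τ : ℝ≥0) : Vars V Φ where
  t x k := X.time cut ρ s x k
  Ft x p y k :=
    match x, y with
    | some u, some _ => X.value cut ρ s p u k
    | some u, none => X.arr u p.1 (s + τ) - N.rate p.1 * τ
    | none, _ => X.dep ρ p.1 s

variable {X cut ρ s}

@[simp] lemma Trajectory.time_none {k : ℕ} : X.time cut ρ s none k = s := by
  simp [Trajectory.time, Trajectory.timeAux]

variable {v u : V} {k k' : ℕ} {p : Φ × V}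

lemma Trajectory.time_of_le (hcut : N.IsForestCut c cut) (hv : v ∈ N.subtree c cut ρ)
    (hk : k ≤ N.dp c cut ρ (N.sc c cut ρ v)) :
    X.time cut ρ s (some v) k = X.fifoTime v (X.time cut ρ s (N.sc c cut ρ v) k) := by
  have h := hcut.dp_some hv
  rw [Trajectory.time, h, Trajectory.timeAux, if_pos (by omega), Trajectory.time]

lemma Trajectory.time_dp (hcut : N.IsForestCut c cut) (hv : v ∈ N.subtree c cut ρ) :
    X.time cut ρ s (some v) (N.dp c cut ρ (some v)) =
      X.backlogStart v
        (X.time cut ρ s (N.sc c cut ρ v) (N.dp c cut ρ (N.sc c cut ρ v))) := by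
  have h := hcut.dp_some hv
  rw [Trajectory.time, h, Trajectory.timeAux, if_neg (by omega), Trajectory.time]

lemma Trajectory.time_succ_le (hcut : N.IsForestCut c cut) (hv : v ∈ N.subtree c cut ρ)
    (hk : k + 1 ≤ N.dp c cut ρ (some v)) :
    X.time cut ρ s (some v) (k + 1) ≤ X.time cut ρ s (some v) k := by
  have main : ∀ n v, v ∈ N.subtree c cut ρ → N.dp c cut ρ (some v) = n → ∀ k, k + 1 ≤ n →
      X.time cut ρ s (some v) (k + 1) ≤ X.time cut ρ s (some v) k := by
    intro n
    induction n with
    | zero => intro v _ _ k hk; omega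
    | succ n ih =>
      intro v hv hn k hk
      have h := hcut.dp_some hv
      rw [X.time_of_le hcut hv (k := k) (by omega)]
      rcases Nat.lt_or_ge k (N.dp c cut ρ (N.sc c cut ρ v)) with hlt | hge
      · rw [X.time_of_le hcut hv (by omega)]
        refine X.fifoTime_mono ?_
        rcases hcut.sc_cases hv with ⟨-, hs⟩ | ⟨u, hu, hs, -⟩
        · simp [hs]
        · rw [hs] at h hlt ⊢
          exact ih u hu (by omega) k (by omega)
      · obtain rfl : k = N.dp c cut ρ (N.sc c cut ρ v) := by omega
        rw [← h, X.time_dp hcut hv]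
        exact X.backlogStart_le_fifoTime
  exact main _ v hv rfl k hk

lemma Trajectory.time_anti (hcut : N.IsForestCut c cut) (hv : v ∈ N.subtree c cut ρ)
    (hkk' : k ≤ k') (hk : k' ≤ N.dp c cut ρ (some v)) :
    X.time cut ρ s (some v) k' ≤ X.time cut ρ s (some v) k := by
  induction k', hkk' using Nat.le_induction with
  | base => rfl
  | succ m hm ih => exact (X.time_succ_le hcut hv hk).trans (ih (by omega))

lemma Trajectory.time_le (hcut : N.IsForestCut c cut) (hv : v ∈ N.subtree c cut ρ)
    (hk : k ≤ N.dp c cut ρ (some v)) : X.time cut ρ s (some v) k ≤ s := by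
  refine (X.time_anti hcut hv (Nat.zero_le k) hk).trans ?_
  clear hk
  induction hv using Relation.ReflTransGen.head_induction_on with
  | refl =>
    rw [X.time_of_le hcut .refl (Nat.zero_le _)]
    exact X.fifoTime_le.trans (by simp)
  | @head a b hab hb ih =>
    rw [X.time_of_le hcut (.head hab hb) (Nat.zero_le _)]
    refine X.fifoTime_le.trans ?_
    rcases hcut.sc_cases (ρ := ρ) (.head hab hb) with ⟨-, h⟩ | ⟨u, -, h, hu⟩
    · simp [h]
    · rw [h, hcut.unique a u b hu hab]
      exact ih

lemma Trajectory.value_of_le (hcut : N.IsForestCut c cut) (hu : u ∈ N.subtree c cut ρ)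
    (hpu : N.Visits cut p u) (hk : k ≤ N.dp c cut ρ (N.sc c cut ρ u)) :
    X.value cut ρ s p u k = X.dep u p.1 (X.time cut ρ s (N.sc c cut ρ u) k) := by
  have h := hcut.dp_some hu
  rw [Trajectory.value, if_pos hpu, if_pos (by omega)]

lemma Trajectory.value_dp (hpu : N.Visits cut p u) :
    X.value cut ρ s p u (N.dp c cut ρ (some u)) =
      X.arr u p.1 (X.time cut ρ s (some u) (N.dp c cut ρ (some u))) := by
  rw [Trajectory.value, if_pos hpu, if_neg (lt_irrefl _)]

lemma Trajectory.arr_le_value (hcut : N.IsForestCut c cut) (hp : N.IsPiece c cut p)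
    (hu : u ∈ N.subtree c cut ρ) (hpu : N.Visits cut p u) (hk : k ≤ N.dp c cut ρ (some u)) :
    X.arr u p.1 (X.time cut ρ s (some u) k) ≤ X.value cut ρ s p u k := by
  have h := hcut.dp_some hu
  have hf := Network.mem_flowsAt_of_visits hp hpu
  rcases hk.lt_or_eq with hlt | rfl
  · rw [X.value_of_le hcut hu hpu (by omega), X.time_of_le hcut hu (by omega)]
    exact X.arr_fifoTime_le hf
  · rw [X.value_dp hpu]

lemma Trajectory.value_le_arr (hcut : N.IsForestCut c cut) (hp : N.IsPiece c cut p)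
    (hu : u ∈ N.subtree c cut ρ) (hpu : N.Visits cut p u) (hk : k ≤ N.dp c cut ρ (some u))
    {y : ℝ≥0} (hy : X.time cut ρ s (some u) k < y) :
    X.value cut ρ s p u k ≤ X.arr u p.1 y := by
  have h := hcut.dp_some hu
  have hf := Network.mem_flowsAt_of_visits hp hpu
  rcases hk.lt_or_eq with hlt | rfl
  · rw [X.value_of_le hcut hu hpu (by omega)]
    rw [X.time_of_le hcut hu (by omega)] at hy
    exact X.le_arr_of_fifoTime_lt hf hy
  · rw [X.value_dp hpu]
    exact (X.arr_cumulative u p.1 hf).mono hy.le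

/-- Away from its source node a flow arrives continuously, so its value is that of the trajectory,
and it equals the departures from the previous node. -/
lemma Trajectory.value_eq_dep_pred (hcut : N.IsForestCut c cut) (hp : N.IsPiece c cut p)
    (hu : u ∈ N.subtree c cut ρ) (hpu : N.Visits cut p u) (hvu : N.Carries p.1 v u)
    (hk : k ≤ N.dp c cut ρ (some u)) :
    X.value cut ρ s p u k = X.dep v p.1 (X.time cut ρ s (some u) k) := by
  have hl := X.link v u p.1 (Network.mem_flowsOn.2 ⟨hp.1, hvu⟩)
  have hc := X.dep_continuous v p.1 (Network.mem_flowsAt.2 ⟨hp.1, hvu.left_mem⟩)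
  rw [← hl] at hc ⊢
  exact le_antisymm (le_apply_of_forall_gt hc.continuousAt fun y hy =>
    X.value_le_arr hcut hp hu hpu hk hy) (X.arr_le_value hcut hp hu hpu hk)

/-- The value at the successor of a node that `p` visits is the departures from this node, whether
or not `p` itself continues to the successor. -/
lemma Trajectory.value_succ (hcut : N.IsForestCut c cut) (hp : N.IsPiece c cut p)
    (hu : u ∈ N.subtree c cut ρ) (hvu : N.sc c cut ρ v = some u) (hpv : N.Visits cut p v)
    (hk : k ≤ N.dp c cut ρ (some u)) :
    X.value cut ρ s p u k = X.dep v p.1 (X.time cut ρ s (some u) k) := by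
  have hE := (Network.sc_eq_some hvu).2
  by_cases hpu : N.Visits cut p u
  · exact X.value_eq_dep_pred hcut hp hu hpu (hcut.carries_of_visits hp hE hpv hpu) hk
  · have hex : ∃ v, N.sc c cut ρ v = some u ∧ N.Visits cut p v := ⟨v, hvu, hpv⟩
    rw [Trajectory.value, if_neg hpu, dif_pos hex,
      hcut.pred_unique hp (Network.sc_eq_some hex.choose_spec.1).2 hE hex.choose_spec.2 hpv hpu]

lemma Trajectory.vars_succ {τ : ℝ≥0} (hcut : N.IsForestCut c cut) (hp : N.IsPiece c cut p)
    (hv : v ∈ N.subtree c cut ρ) (hpv : N.Visits cut p v)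
    (hk : k ≤ N.dp c cut ρ (N.sc c cut ρ v)) :
    (X.vars cut ρ s τ).Ft (N.sc c cut ρ v) p (N.sc c cut ρ v) k =
      X.dep v p.1 (X.time cut ρ s (N.sc c cut ρ v) k) := by
  rcases hcut.sc_cases hv with ⟨rfl, -⟩ | ⟨u, hu, h, -⟩
  · simp [Trajectory.vars]
  · rw [h] at hk ⊢
    exact X.value_succ hcut hp hu h hpv hk

/-- At its source node, every flow of the cut network is constrained by its burstiness bound. -/
lemma Trajectory.pieceBurst_bound {z : V → V → Φ → ℝ≥0∞} (hz : X.CutBurstBound cut z)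
    (hp : N.IsPiece c cut p) :
    HasArrivalCurve (X.arr p.2 p.1) (tokenBucket (N.rate p.1) (N.pieceBurst z p : EReal)) := by
  unfold Network.pieceBurst
  split_ifs with h
  · exact X.source p.1 hp.1 p.2 h
  · obtain ⟨hcls, h' | ⟨w, hw, hc⟩⟩ := hp
    · exact absurd h' h
    have hinf : (⨅ (w' : V) (_ : N.Carries p.1 w' p.2), z w' p.2 p.1) = z w p.2 p.1 :=
      le_antisymm (iInf₂_le w hw) (le_iInf₂ fun w' hw' => by rw [hw'.left_unique hw])
    have hf : p.1 ∈ N.flowsOn c w p.2 := Network.mem_flowsOn.2 ⟨hcls, hw⟩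
    rw [hinf, X.link w p.2 p.1 hf]
    exact hz w p.2 hc p.1 hf

lemma Trajectory.dep_le_arr_of_visits {p : Φ × V} (hp : N.IsPiece c cut p) {v : V}
    (hv : N.Visits cut p v) (t : ℝ≥0) : X.dep v p.1 t ≤ X.arr p.2 p.1 t := by
  suffices h : X.arr v p.1 t ≤ X.arr p.2 p.1 t from
    (X.causal v p.1 (Network.mem_flowsAt_of_visits hp hv) t).trans h
  induction hv with
  | refl => rfl
  | @tail a b ha hab ih =>
    rw [X.link a b p.1 (Network.mem_flowsOn.2 ⟨hp.1, hab.1⟩)]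
    exact (X.causal a p.1 (Network.mem_flowsAt_of_visits hp ha) t).trans ih

end

/-! ### Feasibility -/

section

variable {V Φ C : Type*} [Fintype V] [Fintype Φ] {N : Network V Φ C} {c : C}
  {X : Trajectory N c} {cut : Set (V × V)} {ρ : V} {s : ℝ≥0}

/-- Aggregated over the flows of the cut network, the values at the successor of `v` at its last
index are the departures of the class from `v`, and those at `v` at its last index the arrivals at
the start of the backlogged period. -/
lemma Trajectory.sum_vars_succ {τ : ℝ≥0} (hcut : N.IsForestCut c cut) {v : V}
    (hv : v ∈ N.subtree c cut ρ) :
    ∑ p ∈ N.piecesAt c cut v, (X.vars cut ρ s τ).Ft (N.sc c cut ρ v) p (N.sc c cut ρ v)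
        (N.dp c cut ρ (N.sc c cut ρ v)) =
      ∑ f ∈ N.flowsAt c v,
        X.dep v f (X.time cut ρ s (N.sc c cut ρ v) (N.dp c cut ρ (N.sc c cut ρ v))) ∧
    ∑ p ∈ N.piecesAt c cut v,
        (X.vars cut ρ s τ).Ft (some v) p (some v) (N.dp c cut ρ (some v)) =
      ∑ f ∈ N.flowsAt c v, X.arr v f (X.backlogStart v
        (X.time cut ρ s (N.sc c cut ρ v) (N.dp c cut ρ (N.sc c cut ρ v)))) := by
  constructor
  · refine Eq.trans (Finset.sum_congr rfl fun p hp => ?_)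
      (Network.sum_piecesThrough (cut := cut) (.node v) fun f =>
        X.dep v f (X.time cut ρ s (N.sc c cut ρ v) (N.dp c cut ρ (N.sc c cut ρ v))))
    obtain ⟨hp, hpv⟩ := Network.mem_piecesAt.1 hp
    exact X.vars_succ hcut hp hv hpv le_rfl
  · refine Eq.trans (Finset.sum_congr rfl fun p hp => ?_)
      (Network.sum_piecesThrough (cut := cut) (.node v) fun f => X.arr v f (X.backlogStart v
        (X.time cut ρ s (N.sc c cut ρ v) (N.dp c cut ρ (N.sc c cut ρ v)))))
    obtain ⟨hp, hpv⟩ := Network.mem_piecesAt.1 hp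
    rw [← X.time_dp hcut hv]
    exact X.value_dp hpv

lemma Trajectory.feasible_vars (hcut : N.IsForestCut c cut) {β : V → Finset (ℝ≥0 × ℝ≥0)}
    {d : V → ℝ≥0∞} {z : V → V → Φ → ℝ≥0∞} (hβ : X.StrictService β) (hd : X.DelayBound d)
    (hz : X.CutBurstBound cut z) (g : Place V) {τ : ℝ≥0} (hτ : τ ≠ 0) :
    Feasible N c cut β d z g.root (N.piecesThrough c cut g) (X.vars cut g.root s τ) where
  time_index v hv k hk := NNReal.coe_le_coe.2 (X.time_succ_le hcut hv hk)
  time_succ v hv k hk := by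
    refine NNReal.coe_le_coe.2 ?_
    rw [X.time_of_le hcut hv hk]
    exact X.fifoTime_le
  fifo v hv k hk p hp := by
    obtain ⟨hp, hpv⟩ := Network.mem_piecesAt.1 hp
    rw [X.vars_succ hcut hp hv hpv hk]
    exact X.value_of_le hcut hv hpv hk
  service_nonneg v hv := by
    rw [(X.sum_vars_succ hcut hv).1, (X.sum_vars_succ hcut hv).2, sub_nonneg]
    exact Finset.sum_le_sum fun f hf => X.arr_backlogStart_le hf
  service v hv q hq := by
    rw [(X.sum_vars_succ hcut hv).1, (X.sum_vars_succ hcut hv).2]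
    simp only [Trajectory.vars]
    rw [X.time_dp hcut hv]
    exact hβ.service_le hq
  delay v hv k hk := by
    simp only [Trajectory.vars]
    rw [X.time_of_le hcut hv hk]
    exact hd.sub_fifoTime_le
  arrival p hp hps k k' hkk' hk' :=
    tokenBucket_bound_of_jump (X.pieceBurst_bound hz hp) (X.time_anti hcut hps hkk'.le hk')
      (fun _ hy => X.value_le_arr hcut hp hps .refl (hkk'.le.trans hk') hy)
      (X.arr_le_value hcut hp hps .refl hk')
  shaping v hv u hvu k k' hkk' hk' := by
    classical
    obtain ⟨hvρ, hE⟩ := Network.sc_eq_some hvu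
    have hu : u ∈ N.subtree c cut g.root := by
      rcases hcut.sc_cases hv with ⟨h, -⟩ | ⟨u', hu', h, -⟩
      · exact absurd h hvρ
      · exact Option.some_inj.1 (h.symm.trans hvu) ▸ hu'
    have hT := X.time_anti (s := s) hcut hu hkk'.le hk'
    have hval : ∀ p ∈ N.piecesOn c cut v u, ∀ i ≤ N.dp c cut g.root (some u),
        (X.vars cut g.root s τ).Ft (some u) p (some u) i =
          X.dep v p.1 (X.time cut g.root s (some u) i) := fun p hp i hi =>
      X.value_succ hcut (Network.mem_piecesOn.1 hp).1 hu hvu (Network.mem_piecesOn.1 hp).2.1 hi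
    calc _ ≤ ∑ p ∈ N.piecesOn c cut v u, ((X.vars cut g.root s τ).Ft (some u) p (some u) k -
            (X.vars cut g.root s τ).Ft (some u) p (some u) k') := by
          refine Finset.sum_le_sum_of_subset_of_nonneg Finset.sdiff_subset fun p hp _ => ?_
          rw [hval p hp k (hkk'.le.trans hk'), hval p hp k' hk', sub_nonneg]
          obtain ⟨h1, h2, -⟩ := Network.mem_piecesOn.1 hp
          exact (X.dep_cumulative v p.1 (Network.mem_flowsAt_of_visits h1 h2)).mono hT
      _ = ∑ f ∈ N.flowsOn c v u, (X.dep v f (X.time cut g.root s (some u) k) -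
            X.dep v f (X.time cut g.root s (some u) k')) := by
          refine Eq.trans (Finset.sum_congr rfl fun p hp => ?_)
            (Network.sum_piecesThrough (cut := cut) (.edge v u) fun f =>
              X.dep v f (X.time cut g.root s (some u) k) -
              X.dep v f (X.time cut g.root s (some u) k'))
          rw [hval p hp k (hkk'.le.trans hk'), hval p hp k' hk']
      _ ≤ _ := by
          rcases hT.eq_or_lt with h | h
          · simp only [Trajectory.vars, h, sub_self, mul_zero, Finset.sum_const_zero, add_zero]
            exact (N.maxPacket c).2
          · have hb := tokenBucket_bound (X.shaping v u) h
            have e : (((N.maxPacket c : ℝ≥0) : ℝ≥0∞) : EReal) = ((N.maxPacket c : ℝ) : EReal) :=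
              rfl
            rw [e, EReal.coe_le_coe_iff] at hb
            rw [Finset.sum_sub_distrib]
            simp only [Trajectory.vars]
            linarith
  monotone p hp hps k hk := by
    have h := hcut.dp_some hps
    have hf := Network.mem_flowsAt_of_visits hp (.refl : N.Visits cut p p.2)
    change X.value cut g.root s p p.2 (k + 1) ≤ X.value cut g.root s p p.2 k
    rw [X.value_of_le (k := k) hcut hps .refl (by omega)]
    rcases hk.lt_or_eq with hlt | heq
    · rw [X.value_of_le hcut hps .refl (by omega)]
      refine (X.dep_cumulative _ _ hf).mono ?_
      rcases hcut.sc_cases hps with ⟨-, hs⟩ | ⟨u, hu, hs, -⟩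
      · simp [hs]
      · rw [hs] at h ⊢
        exact X.time_succ_le hcut hu (by omega)
    · rw [heq, X.value_dp .refl, X.time_dp hcut hps,
        show k = N.dp c cut g.root (N.sc c cut g.root p.2) by omega]
      exact X.arr_backlogStart_le hf
  interest p hp k hk := by
    obtain ⟨hp, hpρ⟩ := Network.mem_piecesAt.1 (Network.mem_piecesAt_of_mem_piecesThrough hp)
    have hps : p.2 ∈ N.subtree c cut g.root := hpρ.source_mem_subtree hp .refl
    have hlt : X.time cut g.root s (some p.2) k < s + τ :=
      (X.time_le hcut hps hk).trans_lt (lt_add_of_pos_right s (pos_iff_ne_zero.2 hτ))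
    refine le_trans ?_ (tokenBucket_bound (X.pieceBurst_bound hz hp) hlt)
    rw [EReal.coe_le_coe_iff]
    have := X.arr_le_value (s := s) hcut hp hps .refl hk
    simp only [Trajectory.vars, Trajectory.time_none]
    push_cast
    linarith

lemma Trajectory.le_objective_vars (g : Place V) (τ : ℝ≥0) :
    X.output g (s + τ) - X.output g s - (∑ f ∈ N.flowsThrough c g, N.rate f : ℝ≥0) * τ ≤
      objective (N.piecesThrough c cut g) (X.vars cut g.root s τ) := by
  calc _ = ∑ f ∈ N.flowsThrough c g,
        (X.dep g.root f (s + τ) - X.dep g.root f s - N.rate f * τ) := by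
        simp only [Trajectory.output, Finset.sum_sub_distrib, NNReal.coe_sum, Finset.sum_mul]
    _ = ∑ p ∈ N.piecesThrough c cut g,
        (X.dep g.root p.1 (s + τ) - X.dep g.root p.1 s - N.rate p.1 * τ) :=
        (Network.sum_piecesThrough g _).symm
    _ ≤ _ := by
        refine Finset.sum_le_sum fun p hp => ?_
        obtain ⟨hp, hpρ⟩ := Network.mem_piecesAt.1 (Network.mem_piecesAt_of_mem_piecesThrough hp)
        have := X.dep_le_arr_of_visits hp hpρ (s + τ)
        simp only [Trajectory.vars]
        linarith

end

end PLP

theorem theorem1 {V Φ C : Type*} [Fintype V] [Fintype Φ]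
    (N : PLP.Network V Φ C) (c : C)
    (cut : Set (V × V)) (hcut : N.IsForestCut c cut)
    (β : V → Finset (ℝ≥0 × ℝ≥0)) (d : V → ℝ≥0∞) (z : V → V → Φ → ℝ≥0∞)
    (X : PLP.Trajectory N c)
    (hβ : X.StrictService β) (hd : X.DelayBound d) (hz : X.CutBurstBound cut z)
    (g : PLP.Place V) :
    PLP.HasArrivalCurve (X.output g)
      (PLP.tokenBucket (∑ f ∈ N.flowsThrough c g, N.rate f)
        (PLP.plpBacklog N c cut β d z g)) := by
  intro s τ
  rw [PLP.tokenBucket]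
  split_ifs with hτ
  · simp [hτ]
  · have hopt : ((PLP.objective (N.piecesThrough c cut g) (X.vars cut g.root s τ) : ℝ) : EReal) ≤
        PLP.plpBacklog N c cut β d z g :=
      le_sSup ⟨_, X.feasible_vars hcut hβ hd hz g hτ, rfl⟩
    refine le_trans ?_ (add_le_add_left hopt _)
    rw [← EReal.coe_add, EReal.coe_le_coe_iff]
    have := X.le_objective_vars (cut := cut) (s := s) g τ
    linarith
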